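/- Let $X$ be a complete $\mathrm{CAT}(1)$ space that is admissible, i.e. $d(w,w')<\pi/2$ for all $w,w'\in X$, and let $f:X\to(-\infty,\infty]$ be proper, lower semicontinuous and convex, where convexity means $f(\alpha x\oplus(1-\alpha)y)\le\alpha f(x)+(1-\alpha)f(y)$ for all $x,y\in X$, $\alpha\in(0,1)$; here $\alpha x\oplus(1-\alpha)y=c((1-\alpha)d(x,y))$ for the geodesic path $c:[0,d(x,y)]\to X$ from $x$ to $y$. For $\eta>0$ let $R_{\eta f}$ be the resolvent of $\eta f$: $$R_{\eta f}x=\operatorname*{Argmin}_{y\in X}\bigl\{\eta f(y)+\tan d(y,x)\,\sin d(y,x)\bigr\}\qquad(x\in X).$$ Let $v,y_1\in X$ and $$y_{n+1}=\alpha_n v\oplus(1-\alpha_n)R_{\lambda_n f}y_n\qquad(n=1,2,\dots),$$ where $\{\alpha_n\}\subset(0,1]$ and $\{\lambda_n\}\subset(0,\infty)$ satisfy $$\lim_{n\to\infty}\alpha_n=0,\qquad\sum_{n=1}^\infty\alpha_n^2=\infty,\qquad\inf_n\lambda_n>0.$$ Suppose that the set $\operatorname{Argmin}_Xf$ of all minimizers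 of $f$ is nonempty. Then the minimizer defining $R_{\eta f}x$ exists and is unique for all $\eta>0$ and $x\in X$, every point of $X$ has a unique nearest point in $\operatorname{Argmin}_Xf$, and both $\{y_n\}$ and $\{R_{\lambda_nf}y_n\}$ converge to $Pv$, where $P$ is the metric projection of $X$ onto $\operatorname{Argmin}_Xf$. -/

import Mathlib

open Set Filter Topology

namespace CatOne

/-- `c` (restricted to `[0, l]`, `l = ρ x y`) is a geodesic path from `x` to `y` with respect to the
distance function `ρ`. -/
def IsGeodesicPath {M : Type*} (ρ : M → M → ℝ) (x y : M) (c : ℝ → M) : Prop :=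
  c 0 = x ∧ c (ρ x y) = y ∧
    ∀ t₁ ∈ Icc (0 : ℝ) (ρ x y), ∀ t₂ ∈ Icc (0 : ℝ) (ρ x y), ρ (c t₁) (c t₂) = |t₁ - t₂|

/-- `S` is a geodesic segment between `x` and `y`: the image of a geodesic path. -/
def IsGeodesicSegment {M : Type*} (ρ : M → M → ℝ) (x y : M) (S : Set M) : Prop :=
  ∃ c : ℝ → M, IsGeodesicPath ρ x y c ∧ S = c '' Icc (0 : ℝ) (ρ x y)

/-- `z` is a point `α x ⊕ (1 - α) y`, that is, `z = c ((1 - α) l)` for a geodesic path `c` from `x`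
to `y`, `l = d(x, y)`. (Geodesics between points at distance less than `π` of a `CAT(1)` space are
unique, so `z` is then determined by `α`, `x`, `y`.) -/
def IsConvComb {X : Type*} [MetricSpace X] (α : ℝ) (x y z : X) : Prop :=
  ∃ c : ℝ → X, IsGeodesicPath dist x y c ∧ z = c ((1 - α) * dist x y)

/-- The unit sphere of the three dimensional Euclidean space. -/
abbrev Sphere2 : Type := Metric.sphere (0 : EuclideanSpace ℝ (Fin 3)) 1

/-- The spherical metric on the unit sphere. -/
noncomputable def sphDist (x y : Sphere2) : ℝ :=
  Real.arccos (inner ℝ (x : EuclideanSpace ℝ (Fin 3)) (y : EuclideanSpace ℝ (Fin 3)))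

/-- The sets `S i j` are the sides (each side listed in both orders) of a geodesic triangle with
vertices `x 0`, `x 1`, `x 2`. -/
def IsGeodesicTriangle {M : Type*} (ρ : M → M → ℝ) (x : Fin 3 → M)
    (S : Fin 3 → Fin 3 → Set M) : Prop :=
  (∀ i j, IsGeodesicSegment ρ (x i) (x j) (S i j)) ∧ ∀ i j, S i j = S j i

/-- `q` in the triangle `(x', S')` of the sphere is a comparison point for `p` in the triangle
`(x, S)`. -/
def IsComparisonPoint {X : Type*} [MetricSpace X] (x : Fin 3 → X) (S : Fin 3 → Fin 3 → Set X)
    (x' : Fin 3 → Sphere2) (S' : Fin 3 → Fin 3 → Set Sphere2) (p : X) (q : Sphere2) : Prop :=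
  ∃ i j, i ≠ j ∧ p ∈ S i j ∧ q ∈ S' i j ∧ dist (x i) p = sphDist (x' i) q

/-- `CAT(1)` spaces: `π`-geodesic metric spaces in which every geodesic triangle of perimeter less
than `2π` is at least as thin as its comparison triangles in the unit sphere. -/
def IsCAT1 (X : Type*) [MetricSpace X] : Prop :=
  (∀ x y : X, dist x y < Real.pi → ∃ c : ℝ → X, IsGeodesicPath dist x y c) ∧
  ∀ (x : Fin 3 → X) (S : Fin 3 → Fin 3 → Set X)
    (x' : Fin 3 → Sphere2) (S' : Fin 3 → Fin 3 → Set Sphere2),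
    dist (x 0) (x 1) + dist (x 1) (x 2) + dist (x 2) (x 0) < 2 * Real.pi →
    IsGeodesicTriangle dist x S →
    IsGeodesicTriangle sphDist x' S' →
    (∀ i j, dist (x i) (x j) = sphDist (x' i) (x' j)) →
    ∀ (p q : X) (p' q' : Sphere2),
      IsComparisonPoint x S x' S' p p' → IsComparisonPoint x S x' S' q q' →
      dist p q ≤ sphDist p' q'

/-- A metric space is admissible if any two of its points are at distance less than `π/2`. -/
def IsAdmissible (X : Type*) [MetricSpace X] : Prop :=
  ∀ w w' : X, dist w w' < Real.pi / 2

/-- Membership in `Γ₀(X)`: proper lower semicontinuous convex functions of `X` into `(-∞, ∞]`. -/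
structure IsGamma0 {X : Type*} [MetricSpace X] (f : X → EReal) : Prop where
  ne_bot : ∀ x, f x ≠ ⊥
  proper : ∃ a, f a ≠ ⊤
  lsc : LowerSemicontinuous f
  convex : ∀ (x y z : X) (α : ℝ), 0 < α → α < 1 → IsConvComb α x y z →
    f z ≤ (α : EReal) * f x + ((1 - α : ℝ) : EReal) * f y

/-- The set of all minimizers of `f`. -/
def argmin {X : Type*} (f : X → EReal) : Set X :=
  {x | ∀ y, f x ≤ f y}

/-- The function `y ↦ f(y) + tan d(y, x) sin d(y, x)`. -/
noncomputable def resolventFun {X : Type*} [MetricSpace X] (f : X → EReal) (x y : X) : EReal :=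
  f y + ((Real.tan (dist y x) * Real.sin (dist y x) : ℝ) : EReal)

open Classical in
/-- The resolvent `R_f x`: the minimizer of `y ↦ f(y) + tan d(y, x) sin d(y, x)`
(the value `x` where there is no minimizer is immaterial). -/
noncomputable def resolvent {X : Type*} [MetricSpace X] (f : X → EReal) (x : X) : X :=
  if h : ∃ z, z ∈ argmin (resolventFun f x) then h.choose else x

/-- The function `η f`. -/
noncomputable def scale {X : Type*} (η : ℝ) (f : X → EReal) (x : X) : EReal :=
  (η : EReal) * f x

/-- `p` is a point of `C` nearest to `x`. -/
def IsNearestPoint {X : Type*} [MetricSpace X] (C : Set X) (x p : X) : Prop :=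
  p ∈ C ∧ ∀ q ∈ C, dist x p ≤ dist x q

open Classical in
/-- The metric projection onto `C`: the point of `C` nearest to `x`
(the value `x` where there is no nearest point is immaterial). -/
noncomputable def metricProj {X : Type*} [MetricSpace X] (C : Set X) (x : X) : X :=
  if h : ∃ p, IsNearestPoint C x p then h.choose else x

end CatOne

/-! Along a geodesic of a `CAT(1)` space the spherical law of cosines holds as an inequality
(`IsCAT1.cos_convComb`). At midpoints it becomes a uniform convexity estimate, which replaces weak
compactness: nested closed convex sets meeting a fixed ball have a common point nearest to `v`, and
nearest points and resolvents exist and are unique.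

Let `p` be the projection of `v`, `z n` the resolvent of `y n`, and `s n = 1 - cos d(y n, p)`.
Differentiating the resolvent functional along the geodesic from `z n` to `p` shows that `z n` is no
farther from `p` than `y n`, and that `f (z n) - min f` is at most a constant times `cos d(z n, p) -
cos d(y n, p)`.

The core is the estimate `s (n+1) - ε ≤ (1 - α n ^ 2 / 10) * max (s n - ε) 0` for each `ε > 0` and
all large `n`. Either `s` drops by a fixed `δ`, which is more than required once `α n` is small; or
the resolvent step gains little, so `z n` almost minimizes `f`, hence is not much nearer to `v` than
`p` (`IsGamma0.exists_gap`), and `IsCAT1.halpern_step` contracts. Divergence of the sum of `α n ^ 2`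
then forces `s` to zero. No subsequences are needed. -/

namespace CatOne

/-! ### Spherical geometry: arcs and comparison triangles -/

open Real in
theorem arccos_cos_sub {l s t : ℝ} (hl : l ≤ π) (hs : s ∈ Icc 0 l) (ht : t ∈ Icc 0 l) :
    arccos (cos (s - t)) = |s - t| := by
  rw [← cos_abs, arccos_cos (abs_nonneg _)]
  rw [abs_le]; constructor <;> linarith [hs.1, hs.2, ht.1, ht.2]

theorem sphDist_comm (x y : Sphere2) : sphDist x y = sphDist y x := by
  unfold sphDist; rw [real_inner_comm]

theorem inner_self_sphere (x : Sphere2) :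
    inner ℝ (x : EuclideanSpace ℝ (Fin 3)) (x : EuclideanSpace ℝ (Fin 3)) = 1 := by
  rw [real_inner_self_eq_norm_sq, norm_eq_of_mem_sphere]; norm_num

theorem cos_sphDist (x y : Sphere2) : Real.cos (sphDist x y) =
    inner ℝ (x : EuclideanSpace ℝ (Fin 3)) (y : EuclideanSpace ℝ (Fin 3)) := by
  have h := abs_real_inner_le_norm (x : EuclideanSpace ℝ (Fin 3)) (y : EuclideanSpace ℝ (Fin 3))
  rw [norm_eq_of_mem_sphere, norm_eq_of_mem_sphere, one_mul, abs_le] at h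
  exact Real.cos_arccos h.1 h.2

theorem sphDist_self (x : Sphere2) : sphDist x x = 0 := by
  unfold sphDist; rw [inner_self_sphere, Real.arccos_one]

/-- Great circle arcs are geodesic paths of the sphere. -/
theorem exists_sphere_arc (x y : Sphere2) (h : sphDist x y < Real.pi) :
    ∃ c : ℝ → Sphere2, IsGeodesicPath sphDist x y c ∧ ∀ t (w : Sphere2),
      Real.sin (sphDist x y) * inner ℝ (c t : EuclideanSpace ℝ (Fin 3)) w =
        Real.sin (sphDist x y - t) * inner ℝ (x : EuclideanSpace ℝ (Fin 3)) w +
        Real.sin t * inner ℝ (y : EuclideanSpace ℝ (Fin 3)) w := by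
  have hxy := cos_sphDist x y
  have hxx := inner_self_sphere x
  have hyy := inner_self_sphere y
  have h0 : 0 ≤ sphDist x y := Real.arccos_nonneg _
  rcases h0.eq_or_lt with h0 | h0
  · have e : x = y := by
      rw [← h0, Real.cos_zero] at hxy
      exact Subtype.ext ((inner_eq_one_iff_of_norm_eq_one (𝕜 := ℝ) (norm_eq_of_mem_sphere x)
        (norm_eq_of_mem_sphere y)).1 hxy.symm)
    subst e
    refine ⟨fun _ => x, ⟨rfl, rfl, ?_⟩, ?_⟩
    · intro s hs t ht
      rw [← h0] at hs ht
      rw [← h0, show s = 0 by linarith [hs.1, hs.2], show t = 0 by linarith [ht.1, ht.2]]; simp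
    · intro t w
      rw [← h0]; simp
  set l := sphDist x y
  have hs : Real.sin l ≠ 0 := (Real.sin_pos_of_pos_of_lt_pi h0 h).ne'
  have hsc := Real.sin_sq_add_cos_sq l
  -- Gram–Schmidt: the unit tangent vector at `x` pointing towards `y`.
  let u : EuclideanSpace ℝ (Fin 3) := (Real.sin l)⁻¹ • ((y : EuclideanSpace ℝ (Fin 3)) - Real.cos l • x)
  have hxu : inner ℝ (x : EuclideanSpace ℝ (Fin 3)) u = 0 := by
    simp only [u, inner_smul_right, inner_sub_right, hxx, ← hxy]; ring
  have huu : inner ℝ u u = 1 := by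
    have hyx : inner ℝ (y : EuclideanSpace ℝ (Fin 3)) (x : EuclideanSpace ℝ (Fin 3)) = Real.cos l := by
      rw [real_inner_comm, hxy]
    simp only [u, inner_smul_right, inner_smul_left, inner_sub_right, inner_sub_left, hxx, ← hxy, hyy,
      hyx, RCLike.conj_to_real]
    field_simp
    linarith
  have hux : inner ℝ u (x : EuclideanSpace ℝ (Fin 3)) = 0 := by rw [real_inner_comm, hxu]
  have hcc : ∀ s t : ℝ, inner ℝ (Real.cos s • (x : EuclideanSpace ℝ (Fin 3)) + Real.sin s • u)
      (Real.cos t • (x : EuclideanSpace ℝ (Fin 3)) + Real.sin t • u) = Real.cos (s - t) := by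
    intro s t
    simp only [inner_add_left, inner_add_right, inner_smul_left, inner_smul_right, hxx, hxu, hux, huu,
      RCLike.conj_to_real]
    rw [Real.cos_sub]; ring
  have hy : Real.cos l • (x : EuclideanSpace ℝ (Fin 3)) + Real.sin l • u = y := by
    simp only [u, smul_smul, mul_inv_cancel₀ hs]; simp
  refine ⟨fun t => ⟨Real.cos t • (x : EuclideanSpace ℝ (Fin 3)) + Real.sin t • u, ?_⟩, ⟨?_, ?_, ?_⟩, ?_⟩
  · have := hcc t t
    rw [sub_self, Real.cos_zero, real_inner_self_eq_norm_sq] at this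
    rw [mem_sphere_zero_iff_norm]
    nlinarith [norm_nonneg (Real.cos t • (x : EuclideanSpace ℝ (Fin 3)) + Real.sin t • u)]
  · apply Subtype.ext; simp
  · apply Subtype.ext; exact hy
  · intro s hs t ht
    change Real.arccos (inner ℝ _ _) = _
    rw [hcc, arccos_cos_sub h.le hs ht]
  · intro t w
    have hyw : inner ℝ (y : EuclideanSpace ℝ (Fin 3)) (w : EuclideanSpace ℝ (Fin 3)) =
      Real.cos l * inner ℝ (x : EuclideanSpace ℝ (Fin 3)) w + Real.sin l * inner ℝ u w := by
      rw [← hy]; simp only [inner_add_left, inner_smul_left, RCLike.conj_to_real]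
    rw [hyw]
    simp only [inner_add_left, inner_smul_left, RCLike.conj_to_real]
    rw [Real.sin_sub]
    ring

open Real in
/-- Three lengths less than `π / 2` satisfying the triangle inequalities are the side lengths of a
spherical triangle. -/
theorem exists_comparison_vertices {a b c : ℝ} (ha : 0 ≤ a) (ha' : a < π / 2) (hb : 0 ≤ b)
    (hb' : b < π / 2) (hc : 0 ≤ c) (hc' : c < π / 2) (h1 : a ≤ b + c) (h2 : b ≤ a + c)
    (h3 : c ≤ a + b) :
    ∃ x y w : Sphere2, sphDist x y = a ∧ sphDist x w = b ∧ sphDist y w = c := by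
  -- With `x` the first basis vector and `y` at angle `a` in the first coordinate plane, `q` is the
  -- second coordinate that `⟨y, w⟩ = cos c` forces on `w`. For `a = 0` the division yields `q = 0`,
  -- which is consistent because then `b = c`. The triangle inequalities give `|q| ≤ sin b`, which
  -- leaves room for a third coordinate.
  set q := (cos c - cos a * cos b) / sin a with hq
  have hcb : cos c ≤ cos (a - b) := by
    rw [← cos_abs (a - b)]
    apply cos_le_cos_of_nonneg_of_le_pi (abs_nonneg _) (by linarith)
    rw [abs_le]; constructor <;> linarith
  have hca : cos (a + b) ≤ cos c := cos_le_cos_of_nonneg_of_le_pi hc (by linarith) h3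
  rw [cos_sub] at hcb
  rw [cos_add] at hca
  have hqs : q * sin a = cos c - cos a * cos b := by
    rcases ha.eq_or_lt with h | h
    · subst h
      have : b = c := by linarith
      subst this; simp
    · rw [hq, div_mul_cancel₀ _ (sin_pos_of_pos_of_lt_pi h (by linarith)).ne']
  have hsb : 0 ≤ sin b := sin_nonneg_of_nonneg_of_le_pi hb (by linarith)
  have hsa : 0 ≤ sin a := sin_nonneg_of_nonneg_of_le_pi ha (by linarith)
  have hqb : q ^ 2 ≤ sin b ^ 2 := by
    apply sq_le_sq'
    · rcases hsa.eq_or_lt with h | h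
      · rw [hq, ← h]; simpa using hsb
      · rw [hq, le_div_iff₀ h]; linarith
    · rcases hsa.eq_or_lt with h | h
      · rw [hq, ← h]; simpa using hsb
      · rw [hq, div_le_iff₀ h]; linarith
  set r := √(sin b ^ 2 - q ^ 2)
  have hr : r ^ 2 = sin b ^ 2 - q ^ 2 := sq_sqrt (by linarith)
  have := sin_sq_add_cos_sq a
  have := sin_sq_add_cos_sq b
  refine ⟨⟨!₂[1, 0, 0], ?_⟩, ⟨!₂[cos a, sin a, 0], ?_⟩, ⟨!₂[cos b, q, r], ?_⟩, ?_, ?_, ?_⟩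
  · simp [EuclideanSpace.norm_eq, Fin.sum_univ_three]
  · rw [mem_sphere_zero_iff_norm, EuclideanSpace.norm_eq, sqrt_eq_one]
    simp [Fin.sum_univ_three]
  · rw [mem_sphere_zero_iff_norm, EuclideanSpace.norm_eq, sqrt_eq_one]
    simp [Fin.sum_univ_three]; linarith
  · simp only [sphDist, PiLp.inner_apply, Fin.sum_univ_three]
    simp [arccos_cos ha (by linarith)]
  · simp only [sphDist, PiLp.inner_apply, Fin.sum_univ_three]
    simp [arccos_cos hb (by linarith)]
  · simp only [sphDist, PiLp.inner_apply, Fin.sum_univ_three]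
    simp only [Matrix.cons_val_zero, Matrix.cons_val_one, Matrix.cons_val, RCLike.inner_apply, conj_trivial]
    rw [show cos b * cos a + q * sin a + r * 0 = cos c by rw [hqs]; ring, arccos_cos hc (by linarith)]

/-! ### Geodesic triangles and the cosine inequality -/

theorem IsGeodesicSegment.symm {M : Type*} {ρ : M → M → ℝ} (hρ : ∀ x y, ρ x y = ρ y x) {x y : M}
    {S : Set M} (h : IsGeodesicSegment ρ x y S) : IsGeodesicSegment ρ y x S := by
  obtain ⟨c, ⟨h0, h1, h2⟩, rfl⟩ := h
  refine ⟨fun t => c (ρ x y - t), ⟨?_, ?_, ?_⟩, ?_⟩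
  · simpa using h1
  · simpa [hρ y x] using h0
  · intro s hs t ht
    rw [hρ y x] at hs ht
    rw [h2 _ ⟨by linarith [hs.2], by linarith [hs.1]⟩ _ ⟨by linarith [ht.2], by linarith [ht.1]⟩]
    rw [abs_sub_comm]; congr 1; ring
  · rw [hρ y x]
    ext z; constructor
    · rintro ⟨t, ht, rfl⟩
      exact ⟨ρ x y - t, ⟨by linarith [ht.2], by linarith [ht.1]⟩, by simp⟩
    · rintro ⟨t, ht, rfl⟩
      exact ⟨ρ x y - t, ⟨by linarith [ht.2], by linarith [ht.1]⟩, by simp⟩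

/-- One side of a geodesic triangle can be prescribed. -/
theorem exists_geodesicTriangle {M : Type*} {ρ : M → M → ℝ} (hρ : ∀ x y, ρ x y = ρ y x)
    (x : Fin 3 → M) (hx : ∀ i j, ∃ S, IsGeodesicSegment ρ (x i) (x j) S) {S₀ : Set M}
    (h : IsGeodesicSegment ρ (x 0) (x 1) S₀) :
    ∃ S, IsGeodesicTriangle ρ x S ∧ S 0 1 = S₀ := by
  classical
  choose T hT using hx
  refine ⟨fun i j => if (i = 0 ∧ j = 1) ∨ (i = 1 ∧ j = 0) then S₀ else
    if i ≤ j then T i j else T j i, ⟨?_, ?_⟩, by simp⟩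
  · intro i j
    dsimp only
    split_ifs with h1 h2
    · rcases h1 with ⟨rfl, rfl⟩ | ⟨rfl, rfl⟩
      · exact h
      · exact h.symm hρ
    · exact hT i j
    · exact (hT j i).symm hρ
  · intro i j
    fin_cases i <;> fin_cases j <;> simp

open Real in
/-- The spherical law of cosines as an inequality along geodesics of a `CAT(1)` space. -/
theorem IsCAT1.cos_convComb {X : Type*} [MetricSpace X] (hcat : IsCAT1 X) (hadm : IsAdmissible X)
    {x y z : X} (w : X) {a : ℝ} (ha : a ∈ Icc (0 : ℝ) 1) (h : IsConvComb a x y z) :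
    sin (a * dist x y) * cos (dist x w) + sin ((1 - a) * dist x y) * cos (dist y w) ≤
      sin (dist x y) * cos (dist z w) := by
  obtain ⟨c, hc, rfl⟩ := h
  set l := dist x y with hl
  have hl0 : 0 ≤ l := dist_nonneg
  obtain ⟨x', y', w', hxy, hxw, hyw⟩ := exists_comparison_vertices (a := l) (b := dist x w)
    (c := dist y w) dist_nonneg (hadm _ _) dist_nonneg (hadm _ _) dist_nonneg (hadm _ _)
    (dist_triangle_right _ _ _) (dist_triangle _ _ _) (by rw [hl, dist_comm x y]; exact dist_triangle _ _ _)
  have hπ := pi_pos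
  let V : Fin 3 → X := ![x, y, w]
  let V' : Fin 3 → Sphere2 := ![x', y', w']
  have hV : ∀ i j, dist (V i) (V j) = sphDist (V' i) (V' j) := by
    intro i j
    fin_cases i <;> fin_cases j <;>
      simp [V, V', hxy, hxw, hyw, sphDist_self, sphDist_comm y' x', sphDist_comm w' x',
        sphDist_comm w' y', dist_comm y x, dist_comm w x, dist_comm w y, ← hl]
  obtain ⟨c', hc', hcw⟩ := exists_sphere_arc x' y' (by rw [hxy]; linarith [hadm x y])
  obtain ⟨S, hS, hS01⟩ := exists_geodesicTriangle (ρ := dist) dist_comm V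
    (fun i j => by
      obtain ⟨e, he⟩ := hcat.1 (V i) (V j) (by linarith [hadm (V i) (V j)])
      exact ⟨_, e, he, rfl⟩) (S₀ := c '' Icc 0 l) ⟨c, hc, rfl⟩
  obtain ⟨S', hS', hS01'⟩ := exists_geodesicTriangle (ρ := sphDist) sphDist_comm V'
    (fun i j => by
      obtain ⟨e, he, -⟩ := exists_sphere_arc (V' i) (V' j)
        (by rw [← hV]; linarith [hadm (V i) (V j)])
      exact ⟨_, e, he, rfl⟩) (S₀ := c' '' Icc 0 (sphDist x' y')) ⟨c', hc', rfl⟩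
  have ht : (1 - a) * l ∈ Icc 0 l :=
    ⟨mul_nonneg (by linarith [ha.2]) hl0, by nlinarith [ha.1]⟩
  have hw : IsComparisonPoint V S V' S' w w' := by
    refine ⟨2, 0, by decide, ?_, ?_, ?_⟩
    · obtain ⟨e, he, h⟩ := hS.1 2 0
      rw [h]; exact ⟨0, ⟨le_rfl, dist_nonneg⟩, he.1⟩
    · obtain ⟨e, he, h⟩ := hS'.1 2 0
      rw [h]; exact ⟨0, ⟨le_rfl, arccos_nonneg _⟩, he.1⟩
    · simp [V, V', sphDist_self]
  have hz : IsComparisonPoint V S V' S' (c ((1 - a) * l)) (c' ((1 - a) * l)) := by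
    refine ⟨0, 1, by decide, ?_, ?_, ?_⟩
    · rw [hS01]; exact ⟨_, ht, rfl⟩
    · rw [hS01', hxy]; exact ⟨_, ht, rfl⟩
    · change dist x _ = sphDist x' _
      have e1 := hc.2.2 0 ⟨le_rfl, hl0⟩ _ ht
      have e2 := hc'.2.2 0 ⟨le_rfl, by rw [hxy]; exact hl0⟩ ((1 - a) * l) (by rw [hxy]; exact ht)
      rw [hc.1] at e1
      rw [hc'.1] at e2
      rw [e1, e2]
  have key := hcat.2 V S V' S' (by
    linarith [hadm (V 0) (V 1), hadm (V 1) (V 2), hadm (V 2) (V 0)]) hS hS' hV _ _ _ _ hz hw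
  have hcos := cos_le_cos_of_nonneg_of_le_pi dist_nonneg (arccos_le_pi _) key
  -- On the sphere the law is an equality, the arc being a linear combination of its endpoints; the
  -- comparison inequality enters only through the monotonicity of the cosine.
  have e := hcw ((1 - a) * l) w'
  rw [← cos_sphDist, ← cos_sphDist x' w', ← cos_sphDist y' w', hxy, hxw, hyw, show l - (1 - a) * l = a * l by ring] at e
  rw [← e]
  exact mul_le_mul_of_nonneg_left hcos (sin_nonneg_of_nonneg_of_le_pi hl0 (by linarith [hadm x y]))

/-! ### Uniform convexity, nested convex sets and projections -/

variable {X : Type*} [MetricSpace X]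

theorem IsAdmissible.cos_pos (hadm : IsAdmissible X) (x y : X) : 0 < Real.cos (dist x y) :=
  Real.cos_pos_of_mem_Ioo ⟨by linarith [dist_nonneg (x := x) (y := y), Real.pi_pos], hadm x y⟩

theorem IsAdmissible.cos_le_cos_iff (hadm : IsAdmissible X) {x y z w : X} :
    Real.cos (dist x y) ≤ Real.cos (dist z w) ↔ dist z w ≤ dist x y := by
  have := Real.pi_pos
  exact Real.strictAntiOn_cos.le_iff_ge ⟨dist_nonneg, by linarith [hadm x y]⟩
    ⟨dist_nonneg, by linarith [hadm z w]⟩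

theorem IsCAT1.exists_convComb (hcat : IsCAT1 X) (hadm : IsAdmissible X) (a : ℝ) (x y : X) :
    ∃ z, IsConvComb a x y z := by
  obtain ⟨c, hc⟩ := hcat.1 x y (by linarith [hadm x y, Real.pi_pos])
  exact ⟨_, c, hc, rfl⟩

/-- The case `a = 1/2` of the cosine inequality, divided by `sin (d/2)`. The factor `cos (d/2)`,
smaller than `1` unless the endpoints agree, plays the part of the parallelogram law. -/
theorem IsCAT1.cos_midpoint (hcat : IsCAT1 X) (hadm : IsAdmissible X) {x y z : X} (w : X)
    (h : IsConvComb (1 / 2) x y z) :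
    Real.cos (dist x w) + Real.cos (dist y w) ≤
      2 * Real.cos (dist x y / 2) * Real.cos (dist z w) := by
  have key := hcat.cos_convComb hadm w ⟨by norm_num, by norm_num⟩ h
  rcases (dist_nonneg (x := x) (y := y)).eq_or_lt with h0 | h0
  · obtain ⟨c, hc, rfl⟩ := h
    have : x = y := dist_eq_zero.1 h0.symm
    subst this
    simp only [dist_self, mul_zero, hc.1, zero_div, Real.cos_zero]
    linarith
  · have hs : 0 < Real.sin (dist x y / 2) :=
      Real.sin_pos_of_pos_of_lt_pi (by linarith) (by linarith [hadm x y, Real.pi_pos])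
    rw [show (1 - 1 / 2 : ℝ) * dist x y = dist x y / 2 by ring,
      show (1 / 2 : ℝ) * dist x y = dist x y / 2 by ring,
      show Real.sin (dist x y) = 2 * Real.sin (dist x y / 2) * Real.cos (dist x y / 2) by
        rw [← Real.sin_two_mul]; congr 1; ring] at key
    refine le_of_mul_le_mul_left ?_ hs
    linarith

/-- Turns cosine gaps into distances, by `1 - cos (d/2) = 2 sin² (d/4)` and `sin (d/4) ≥ d/8`. -/
theorem IsAdmissible.sq_dist_le (hadm : IsAdmissible X) (x y : X) :
    dist x y ^ 2 ≤ 32 * (1 - Real.cos (dist x y / 2)) := by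
  have h0 : 0 ≤ dist x y := dist_nonneg
  have h1 := Real.mul_le_sin (x := dist x y / 4) (by linarith) (by linarith [hadm x y])
  have h2 : dist x y / 8 ≤ Real.sin (dist x y / 4) := by
    refine le_trans ?_ h1
    have : (1 : ℝ) / 2 ≤ 2 / Real.pi := by
      rw [div_le_div_iff₀ (by norm_num) Real.pi_pos]; linarith [Real.pi_le_four]
    nlinarith
  have h3 : Real.cos (dist x y / 2) = 1 - 2 * Real.sin (dist x y / 4) ^ 2 := by
    rw [show dist x y / 2 = 2 * (dist x y / 4) by ring, Real.cos_two_mul, Real.cos_sq']; ring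
  rw [h3]
  nlinarith

/-- A form of Cantor's intersection theorem. -/
theorem IsAdmissible.exists_forall_mem [CompleteSpace X] (hadm : IsAdmissible X) {D : ℕ → Set X}
    (hcl : ∀ k, IsClosed (D k)) (hanti : Antitone D) (hne : ∀ k, (D k).Nonempty) {e : ℕ → ℝ}
    (he : Tendsto e atTop (𝓝 0))
    (hD : ∀ k, ∀ x ∈ D k, ∀ y ∈ D k, 1 - e k ≤ Real.cos (dist x y / 2)) :
    ∃ x, ∀ k, x ∈ D k := by
  choose u hu using hne
  have hc : CauchySeq u := by
    refine cauchySeq_of_le_tendsto_0 (fun k => √(32 * e k)) (fun n m N hn hm => ?_) ?_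
    · apply Real.le_sqrt_of_sq_le
      have := hadm.sq_dist_le (u n) (u m)
      have := hD N _ (hanti hn (hu n)) _ (hanti hm (hu m))
      linarith
    · have := (he.const_mul 32).sqrt
      simpa using this
  obtain ⟨x, hx⟩ := cauchySeq_tendsto_of_complete hc
  exact ⟨x, fun k => (hcl k).mem_of_tendsto hx
    (eventually_atTop.2 ⟨k, fun n hn => hanti hn (hu n)⟩)⟩

/-- A nested sequence of closed convex sets, all of which meet a fixed ball of radius less than
`π / 2` around `v`, has a common point in that ball, nearest to `v` among all common points. -/
theorem IsCAT1.exists_nearest_iInter [CompleteSpace X] (hcat : IsCAT1 X) (hadm : IsAdmissible X)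
    {C : ℕ → Set X} (hcl : ∀ k, IsClosed (C k)) (hanti : Antitone C)
    (hconv : ∀ k, ∀ x ∈ C k, ∀ y ∈ C k, ∀ z, IsConvComb (1 / 2) x y z → z ∈ C k) (v : X) {c : ℝ}
    (hc : 0 < c) (hne : ∀ k, ∃ x ∈ C k, c ≤ Real.cos (dist v x)) :
    ∃ x, (∀ k, x ∈ C k) ∧ c ≤ Real.cos (dist v x) ∧
      ∀ y, (∀ k, y ∈ C k) → dist v x ≤ dist v y := by
  let A : ℕ → ℝ := fun k => sSup ((fun x => Real.cos (dist v x)) '' C k)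
  have hbdd : ∀ k, BddAbove ((fun x => Real.cos (dist v x)) '' C k) := fun k =>
    ⟨1, by rintro _ ⟨x, -, rfl⟩; exact Real.cos_le_one _⟩
  have hleA : ∀ k, ∀ x ∈ C k, Real.cos (dist v x) ≤ A k := fun k x hx =>
    le_csSup (hbdd k) ⟨x, hx, rfl⟩
  have hAanti : Antitone A := fun i j hij => by
    obtain ⟨x, hx, -⟩ := hne j
    exact csSup_le_csSup (hbdd i) ⟨_, x, hx, rfl⟩ (image_mono (hanti hij))
  have hAc : ∀ k, c ≤ A k := fun k => by
    obtain ⟨x, hx, h⟩ := hne k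
    exact h.trans (hleA k x hx)
  have hAbdd : BddBelow (range A) := ⟨c, by rintro _ ⟨k, rfl⟩; exact hAc k⟩
  have hlim : Tendsto A atTop (𝓝 (⨅ k, A k)) := tendsto_atTop_ciInf hAanti hAbdd
  set B := ⨅ k, A k
  have hcB : c ≤ B := le_ciInf hAc
  have hBA : ∀ k, B ≤ A k := fun k => ciInf_le hAbdd k
  let r : ℕ → ℝ := fun k => 1 / ((k : ℝ) + 1)
  have hr : Tendsto r atTop (𝓝 0) := tendsto_one_div_add_atTop_nhds_zero_nat
  have hr0 : ∀ k, 0 < r k := fun k => Nat.one_div_pos_of_nat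
  have hranti : Antitone r := fun i j hij => Nat.one_div_le_one_div hij
  -- Points of `C k` nearly attaining the limit `B` of the suprema `A k`. The midpoint of two of
  -- them stays in `C k`, so the cosine of half their distance is at least `(B - r k) / A k`, which
  -- tends to `1`.
  let D : ℕ → Set X := fun k => C k ∩ {x | B - r k ≤ Real.cos (dist v x)}
  obtain ⟨x, hx⟩ := hadm.exists_forall_mem (D := D) (e := fun k => 1 - (B - r k) / A k)
    (fun k => (hcl k).inter (isClosed_le continuous_const (by fun_prop)))
    (fun i j hij x hx => ⟨hanti hij hx.1, by
      have h1 : B - r j ≤ Real.cos (dist v x) := hx.2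
      have h2 := hranti hij
      show B - r i ≤ Real.cos (dist v x)
      linarith⟩)
    (fun k => by
      obtain ⟨x, hx, -⟩ := hne k
      obtain ⟨_, ⟨y, hy, rfl⟩, h⟩ := exists_lt_of_lt_csSup (⟨_, x, hx, rfl⟩ :
        ((fun x => Real.cos (dist v x)) '' C k).Nonempty)
        (show B - r k < A k by linarith [hBA k, hr0 k])
      exact ⟨y, hy, h.le⟩)
    (by
      have := ((tendsto_const_nhds (x := B)).sub hr).div hlim (by linarith)
      have := this.const_sub 1
      rwa [sub_zero, div_self (by linarith), sub_self] at this)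
    (fun k x hx y hy => by
      obtain ⟨z, hz⟩ := hcat.exists_convComb hadm (1 / 2) x y
      have h1 := hcat.cos_midpoint hadm v hz
      have h2 := hleA k z (hconv k x hx.1 y hy.1 z hz)
      have h3 : B - r k ≤ Real.cos (dist v x) := hx.2
      have h4 : B - r k ≤ Real.cos (dist v y) := hy.2
      rw [dist_comm x v, dist_comm y v, dist_comm z v] at h1
      have h5 : 0 ≤ Real.cos (dist x y / 2) := Real.cos_nonneg_of_mem_Icc
        ⟨by linarith [Real.pi_pos, dist_nonneg (x := x) (y := y)], by
          linarith [hadm x y, dist_nonneg (x := x) (y := y)]⟩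
      have h6 : (B - r k) / A k ≤ Real.cos (dist x y / 2) := by
        rw [div_le_iff₀ (by linarith [hAc k])]
        nlinarith
      linarith)
  have hBx : B ≤ Real.cos (dist v x) := by
    refine le_of_tendsto (f := fun k => B - r k) (by simpa using hr.const_sub B)
      (Eventually.of_forall fun k => (hx k).2)
  refine ⟨x, fun k => (hx k).1, hcB.trans hBx, fun y hy => ?_⟩
  rw [← hadm.cos_le_cos_iff]
  exact (le_ciInf fun k => hleA k y (hy k)).trans hBx

/-- The projection onto a closed convex set is well defined. -/
theorem IsCAT1.existsUnique_isNearestPoint [CompleteSpace X] (hcat : IsCAT1 X)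
    (hadm : IsAdmissible X) {C : Set X} (hcl : IsClosed C) (hne : C.Nonempty)
    (hconv : ∀ x ∈ C, ∀ y ∈ C, ∀ z, IsConvComb (1 / 2) x y z → z ∈ C) (v : X) :
    ∃! p, IsNearestPoint C v p := by
  obtain ⟨x₀, hx₀⟩ := hne
  obtain ⟨x, hx, -, hmin⟩ := hcat.exists_nearest_iInter hadm (C := fun _ => C) (fun _ => hcl)
    antitone_const (fun _ => hconv) v (hadm.cos_pos v x₀) (fun _ => ⟨x₀, hx₀, le_rfl⟩)
  refine ⟨x, ⟨hx 0, fun q hq => hmin q fun _ => hq⟩, fun y hy => ?_⟩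
  have hxy : dist v y = dist v x := le_antisymm (hy.2 x (hx 0)) (hmin y fun _ => hy.1)
  obtain ⟨z, hz⟩ := hcat.exists_convComb hadm (1 / 2) x y
  have h1 := hcat.cos_midpoint hadm v hz
  have h2 := hadm.cos_le_cos_iff.2 (hmin z fun _ => hconv x (hx 0) y hy.1 z hz)
  rw [dist_comm x v, dist_comm y v, dist_comm z v, hxy] at h1
  have h3 := hadm.cos_pos v z
  have h4 := hadm.cos_pos v x
  have h5 := hadm.sq_dist_le x y
  have h6 : 1 ≤ Real.cos (dist x y / 2) := by
    by_contra! h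
    nlinarith
  exact (dist_eq_zero.1 (pow_eq_zero_iff (n := 2) (by norm_num) |>.1
    (le_antisymm (by linarith) (sq_nonneg _)))).symm

/-! ### Convex functions and their sublevel sets -/

variable {f : X → EReal}

theorem IsGamma0.exists_real (hf : IsGamma0 f) {x : X} (hx : f x ≠ ⊤) : ∃ a : ℝ, f x = a :=
  ⟨(f x).toReal, (EReal.coe_toReal hx (hf.ne_bot x)).symm⟩

theorem IsGamma0.exists_real_of_le (hf : IsGamma0 f) {x : X} {K : ℝ} (hx : f x ≤ K) :
    ∃ a : ℝ, f x = a ∧ a ≤ K := by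
  obtain ⟨a, ha⟩ := hf.exists_real (x := x) (ne_top_of_le_ne_top (EReal.coe_ne_top K) hx)
  exact ⟨a, ha, by rw [ha] at hx; exact_mod_cast hx⟩

theorem IsGamma0.exists_real_convComb (hf : IsGamma0 f) {x y z : X} {a b t : ℝ} (hx : f x = a)
    (hy : f y = b) (h0 : 0 < t) (h1 : t < 1) (hz : IsConvComb t x y z) :
    ∃ c : ℝ, f z = c ∧ c ≤ t * a + (1 - t) * b := by
  apply hf.exists_real_of_le
  have := hf.convex x y z t h0 h1 hz
  rw [hx, hy] at this
  exact_mod_cast this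

theorem IsGamma0.exists_real_of_mem_argmin (hf : IsGamma0 f) {p : X} (hp : p ∈ argmin f) :
    ∃ m : ℝ, f p = m := by
  obtain ⟨a, ha⟩ := hf.proper
  exact hf.exists_real (ne_top_of_le_ne_top ha (hp a))

theorem IsGamma0.sublevel_convex (hf : IsGamma0 f) {x y z : X} {K : ℝ} (hx : f x ≤ K)
    (hy : f y ≤ K) (hz : IsConvComb (1 / 2) x y z) : f z ≤ K := by
  obtain ⟨a, ha, haK⟩ := hf.exists_real_of_le hx
  obtain ⟨b, hb, hbK⟩ := hf.exists_real_of_le hy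
  obtain ⟨c, hc, hcK⟩ := hf.exists_real_convComb ha hb (by norm_num) (by norm_num) hz
  rw [hc]
  exact_mod_cast show c ≤ K by linarith

theorem argmin_eq_sublevel {Y : Type*} {f : Y → EReal} {p : Y} {m : ℝ} (hp : p ∈ argmin f) (hm : f p = m) :
    argmin f = {x | f x ≤ m} := by
  ext x
  refine ⟨fun hx => hm ▸ hx p, fun hx y => le_trans (hm ▸ hx) (hp y)⟩

theorem IsGamma0.existsUnique_isNearestPoint_argmin [CompleteSpace X] (hcat : IsCAT1 X)
    (hadm : IsAdmissible X) (hf : IsGamma0 f) (hne : (argmin f).Nonempty) (x : X) :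
    ∃! p, IsNearestPoint (argmin f) x p := by
  obtain ⟨p, hp⟩ := id hne
  obtain ⟨m, hm⟩ := hf.exists_real_of_mem_argmin hp
  have h := argmin_eq_sublevel hp hm
  refine hcat.existsUnique_isNearestPoint hadm ?_ hne ?_ x
  · rw [h]; exact hf.lsc.isClosed_preimage _
  · rw [h]; exact fun x hx y hy z hz => hf.sublevel_convex hx hy hz

/-- Points where `f` is nearly minimal are not much nearer to `v` than the nearest minimizer. -/
theorem IsGamma0.exists_gap [CompleteSpace X] (hcat : IsCAT1 X) (hadm : IsAdmissible X)
    (hf : IsGamma0 f) {v p : X} (hp : IsNearestPoint (argmin f) v p) {m : ℝ} (hm : f p = m) {c : ℝ}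
    (hc : Real.cos (dist v p) < c) :
    ∃ δ > 0, ∀ z, ∀ a : ℝ, f z = a → a ≤ m + δ → Real.cos (dist v z) < c := by
  by_contra! H
  -- If the claim fails, every sublevel set at height `m + 1/(k+1)` has a point with cosine at least
  -- `c`; a common point of these sets is a minimizer nearer to `v` than `p`.
  obtain ⟨x, hx, hxc, -⟩ := hcat.exists_nearest_iInter hadm
    (C := fun k : ℕ => {x | f x ≤ ((m + 1 / ((k : ℝ) + 1) : ℝ) : EReal)})
    (fun k => hf.lsc.isClosed_preimage _)
    (fun i j hij x hx => le_trans (Set.mem_ofPred.1 hx) (by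
      have : 1 / ((j : ℝ) + 1) ≤ 1 / ((i : ℝ) + 1) := Nat.one_div_le_one_div hij
      exact EReal.coe_le_coe_iff.2 (by linarith)))
    (fun k x hx y hy z hz => hf.sublevel_convex hx hy hz) v (c := c)
    ((hadm.cos_pos v p).trans hc)
    (fun k => by
      obtain ⟨z, a, hz, ha, hcz⟩ := H (1 / ((k : ℝ) + 1)) Nat.one_div_pos_of_nat
      exact ⟨z, by rw [Set.mem_ofPred, hz]; exact_mod_cast ha, hcz⟩)
  have hxm : x ∈ argmin f := by
    rw [argmin_eq_sublevel hp.1 hm]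
    obtain ⟨a, ha, -⟩ := hf.exists_real_of_le (hx 0)
    have h1 : ∀ k : ℕ, a ≤ m + 1 / ((k : ℝ) + 1) := fun k => by
      have := hx k
      rw [Set.mem_ofPred, ha] at this
      exact_mod_cast this
    have h2 : Tendsto (fun k : ℕ => m + 1 / ((k : ℝ) + 1)) atTop (𝓝 m) := by
      simpa using tendsto_one_div_add_atTop_nhds_zero_nat.const_add m
    have h3 : a ≤ m := ge_of_tendsto' h2 h1
    rw [Set.mem_ofPred, ha]
    exact_mod_cast h3
  have := hadm.cos_le_cos_iff.2 (hp.2 x hxm)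
  linarith

/-! ### The resolvent: existence and basic inequalities -/

theorem IsAdmissible.tan_mul_sin (hadm : IsAdmissible X) (x y : X) :
    Real.tan (dist x y) * Real.sin (dist x y) =
      (Real.cos (dist x y))⁻¹ - Real.cos (dist x y) := by
  have := (hadm.cos_pos x y).ne'
  rw [Real.tan_eq_sin_div_cos]
  field_simp
  rw [Real.sin_sq]

/-- In terms of `t = cos d` the penalty is `1/t - t`, convex and decreasing for `0 < t ≤ 1`, so
lower bounds on cosines become upper bounds on the functional. -/
theorem IsAdmissible.resolventFun_eq (hadm : IsAdmissible X) {x y : X} {η a : ℝ} (ha : f y = a) :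
    resolventFun (scale η f) x y =
      ((η * a + ((Real.cos (dist y x))⁻¹ - Real.cos (dist y x)) : ℝ) : EReal) := by
  rw [resolventFun, scale, ha, hadm.tan_mul_sin]
  push_cast; rfl

theorem IsGamma0.exists_real_of_resolventFun_le (hadm : IsAdmissible X) (hf : IsGamma0 f) {x y : X}
    {η K : ℝ} (hη : 0 < η) (h : resolventFun (scale η f) x y ≤ K) :
    ∃ a : ℝ, f y = a ∧ η * a + ((Real.cos (dist y x))⁻¹ - Real.cos (dist y x)) ≤ K := by
  have : f y ≠ ⊤ := by
    intro ht
    rw [resolventFun, scale, ht, EReal.coe_mul_top_of_pos hη, EReal.top_add_coe] at h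
    exact EReal.coe_ne_top K (top_le_iff.1 h)
  obtain ⟨a, ha⟩ := hf.exists_real this
  refine ⟨a, ha, ?_⟩
  rw [hadm.resolventFun_eq ha] at h
  exact_mod_cast h

theorem IsGamma0.lowerSemicontinuous_resolventFun (hadm : IsAdmissible X) (hf : IsGamma0 f)
    (x : X) {η : ℝ} (hη : 0 < η) : LowerSemicontinuous (resolventFun (scale η f) x) := by
  refine LowerSemicontinuous.add' ?_ ?_ ?_
  · have hcont : Continuous fun e : EReal => (η : EReal) * e := by
      rw [continuous_iff_continuousAt]
      intro e
      exact EReal.Tendsto.const_mul tendsto_id (Or.inl (EReal.coe_ne_bot _))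
        (Or.inl (EReal.coe_ne_top _))
    exact hcont.comp_lowerSemicontinuous hf.lsc fun a b hab =>
      mul_le_mul_of_nonneg_left hab (by exact_mod_cast hη.le)
  · apply Continuous.lowerSemicontinuous
    rw [EReal.continuous_coe_iff]
    simp_rw [hadm.tan_mul_sin]
    have : ∀ y, Real.cos (dist y x) ≠ 0 := fun y => (hadm.cos_pos y x).ne'
    fun_prop (disch := assumption)
  · intro y
    exact EReal.continuousAt_add (Or.inr (EReal.coe_ne_bot _)) (Or.inr (EReal.coe_ne_top _))

/-- Uniform convexity of the function defining the resolvent. -/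
theorem IsGamma0.resolventFun_midpoint (hcat : IsCAT1 X) (hadm : IsAdmissible X) (hf : IsGamma0 f)
    {x y z w : X} {η a b : ℝ} (hη : 0 < η) (hy : f y = a) (hz : f z = b)
    (hw : IsConvComb (1 / 2) y z w) :
    ∃ c : ℝ, f w = c ∧ 2 * (η * c + ((Real.cos (dist w x))⁻¹ - Real.cos (dist w x))) +
      2 * (1 - Real.cos (dist y z / 2)) ≤
        (η * a + ((Real.cos (dist y x))⁻¹ - Real.cos (dist y x))) +
        (η * b + ((Real.cos (dist z x))⁻¹ - Real.cos (dist z x))) := by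
  obtain ⟨c, hc, hcab⟩ := hf.exists_real_convComb hy hz (by norm_num) (by norm_num) hw
  refine ⟨c, hc, ?_⟩
  have key := hcat.cos_midpoint hadm x hw
  set A := Real.cos (dist y x)
  set B := Real.cos (dist z x)
  set C := Real.cos (dist w x)
  set κ := Real.cos (dist y z / 2)
  have hA : 0 < A := hadm.cos_pos _ _
  have hB : 0 < B := hadm.cos_pos _ _
  have hC : 0 < C := hadm.cos_pos _ _
  have hA1 : A ≤ 1 := Real.cos_le_one _
  have hB1 : B ≤ 1 := Real.cos_le_one _
  have hκ1 : κ ≤ 1 := Real.cos_le_one _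
  have hηc : 2 * (η * c) ≤ η * a + η * b := by nlinarith
  -- From `A + B ≤ 2κC` and the inequality of harmonic and arithmetic means. As `A⁻¹ + B⁻¹ ≥ 2`, the
  -- factor `κ` accounts for the gain `2(1 - κ)`.
  have h1 : 2 * C⁻¹ ≤ κ * (A⁻¹ + B⁻¹) := by
    have hκ : 0 < κ := by
      by_contra! h
      nlinarith
    rw [← div_eq_mul_inv, div_le_iff₀ hC]
    have h2 : (A⁻¹ + B⁻¹) * (A + B) ≥ 4 := by
      have : (A⁻¹ + B⁻¹) * (A + B) = 4 + (A - B) ^ 2 / (A * B) := by field_simp; ring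
      rw [this]
      have : 0 ≤ (A - B) ^ 2 / (A * B) := by positivity
      linarith
    have h3 : 0 < A⁻¹ + B⁻¹ := by positivity
    nlinarith
  have h2 : A + B ≤ 2 * C := by nlinarith
  have h3 : 1 ≤ A⁻¹ := (one_le_inv₀ hA).2 hA1
  have h4 : 1 ≤ B⁻¹ := (one_le_inv₀ hB).2 hB1
  nlinarith

/-- A minimizer of `f` bounds the functional below, so its infimum `I` is finite. Uniform convexity
shrinks the sets where it is at most `I + 1/(k+1)` to a point. -/
theorem IsGamma0.existsUnique_resolvent [CompleteSpace X] (hcat : IsCAT1 X) (hadm : IsAdmissible X)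
    (hf : IsGamma0 f) (hne : (argmin f).Nonempty) {η : ℝ} (hη : 0 < η) (x : X) :
    ∃! z, z ∈ argmin (resolventFun (scale η f) x) := by
  obtain ⟨p, hp⟩ := hne
  obtain ⟨m, hm⟩ := hf.exists_real_of_mem_argmin hp
  let g : X → ℝ → ℝ := fun y a => η * a + ((Real.cos (dist y x))⁻¹ - Real.cos (dist y x))
  have hg : ∀ {y : X} {a : ℝ}, f y = a → resolventFun (scale η f) x y = (g y a : EReal) :=
    fun ha => hadm.resolventFun_eq ha
  have hlow : ∀ {y : X} {a : ℝ}, f y = a → η * m ≤ g y a := by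
    intro y a ha
    have h1 := hp y
    rw [hm, ha, EReal.coe_le_coe_iff] at h1
    have h2 := hadm.cos_pos y x
    have h3 : 1 ≤ (Real.cos (dist y x))⁻¹ := (one_le_inv₀ h2).2 (Real.cos_le_one _)
    have h4 := Real.cos_le_one (dist y x)
    simp only [g]
    nlinarith
  let V : Set ℝ := {K | ∃ y a, f y = (a : ℝ) ∧ g y a = K}
  have hVb : BddBelow V := ⟨η * m, by rintro _ ⟨y, a, ha, rfl⟩; exact hlow ha⟩
  have hVn : V.Nonempty := ⟨_, p, m, hm, rfl⟩
  set I := sInf V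
  have hI : ∀ {y : X} {a : ℝ}, f y = a → I ≤ g y a := fun ha => csInf_le hVb ⟨_, _, ha, rfl⟩
  have hmid : ∀ {y z : X} {a b : ℝ}, f y = a → f z = b →
      2 * I + 2 * (1 - Real.cos (dist y z / 2)) ≤ g y a + g z b := by
    intro y z a b ha hb
    obtain ⟨w, hw⟩ := hcat.exists_convComb hadm (1 / 2) y z
    obtain ⟨c, hc, h⟩ := hf.resolventFun_midpoint hcat hadm (x := x) hη ha hb hw
    have := hI hc
    simp only [g] at this ⊢
    linarith
  obtain ⟨z, hz⟩ := hadm.exists_forall_mem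
    (D := fun k : ℕ => {y | resolventFun (scale η f) x y ≤ ((I + 1 / ((k : ℝ) + 1) : ℝ) : EReal)})
    (e := fun k => 1 / ((k : ℝ) + 1))
    (fun k => (hf.lowerSemicontinuous_resolventFun hadm x hη).isClosed_preimage _)
    (fun i j hij y hy => le_trans (Set.mem_ofPred.1 hy) (by
      have : 1 / ((j : ℝ) + 1) ≤ 1 / ((i : ℝ) + 1) := Nat.one_div_le_one_div hij
      exact EReal.coe_le_coe_iff.2 (by linarith)))
    (fun k => by
      have h0 : 0 < 1 / ((k : ℝ) + 1) := Nat.one_div_pos_of_nat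
      obtain ⟨_, ⟨y, a, ha, rfl⟩, h⟩ := exists_lt_of_csInf_lt hVn
        (show I < I + 1 / ((k : ℝ) + 1) by linarith)
      exact ⟨y, by rw [Set.mem_ofPred, hg ha]; exact_mod_cast h.le⟩)
    tendsto_one_div_add_atTop_nhds_zero_nat
    (fun k y hy z hz => by
      obtain ⟨a, ha, ha'⟩ := hf.exists_real_of_resolventFun_le hadm hη hy
      obtain ⟨b, hb, hb'⟩ := hf.exists_real_of_resolventFun_le hadm hη hz
      have := hmid ha hb
      simp only [g] at this
      linarith)
  obtain ⟨a, ha, -⟩ := hf.exists_real_of_resolventFun_le hadm hη (hz 0)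
  have hzI : g z a ≤ I := by
    have h2 : Tendsto (fun k : ℕ => I + 1 / ((k : ℝ) + 1)) atTop (𝓝 I) := by
      simpa using tendsto_one_div_add_atTop_nhds_zero_nat.const_add I
    refine ge_of_tendsto' h2 fun k => ?_
    have := hz k
    rw [Set.mem_ofPred, hg ha] at this
    exact_mod_cast this
  have hza : z ∈ argmin (resolventFun (scale η f) x) := by
    intro y
    by_cases hy : f y = ⊤
    · have : resolventFun (scale η f) x y = ⊤ := by
        rw [resolventFun, scale, hy, EReal.coe_mul_top_of_pos hη, EReal.top_add_coe]
      rw [this]; exact le_top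
    · obtain ⟨b, hb⟩ := hf.exists_real hy
      rw [hg ha, hg hb]
      exact_mod_cast hzI.trans (hI hb)
  refine ⟨z, hza, fun y hy => ?_⟩
  have h1 := hy z
  rw [hg ha] at h1
  obtain ⟨b, hb, hb'⟩ := hf.exists_real_of_resolventFun_le hadm hη h1
  have h2 := hmid hb ha
  have h3 := hadm.sq_dist_le y z
  change g y b ≤ g z a at hb'
  exact dist_eq_zero.1 (pow_eq_zero_iff (n := 2) (by norm_num) |>.1
    (le_antisymm (by linarith) (sq_nonneg _)))

theorem resolvent_mem (h : ∃ z, z ∈ argmin (resolventFun f x)) :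
    resolvent f x ∈ argmin (resolventFun f x) := by
  rw [resolvent, dif_pos h]; exact h.choose_spec

theorem isNearestPoint_metricProj {C : Set X} {x : X} (h : ∃ p, IsNearestPoint C x p) :
    IsNearestPoint C x (metricProj C x) := by
  rw [metricProj, dif_pos h]; exact h.choose_spec

/-- The variational inequality characterizing the resolvent. -/
theorem IsGamma0.resolvent_variational (hcat : IsCAT1 X) (hadm : IsAdmissible X) (hf : IsGamma0 f)
    {x z p : X} {η m : ℝ} (hη : 0 < η) (hz : z ∈ argmin (resolventFun (scale η f) x))
    (hm : f p = m) :
    ∃ a : ℝ, f z = a ∧ η * (a - m) * Real.sin (dist p z) ≤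
      (1 + (Real.cos (dist z x) ^ 2)⁻¹) * (dist p z *
        (Real.cos (dist p z) * Real.cos (dist z x) - Real.cos (dist p x))) := by
  have h1 := hz p
  rw [hadm.resolventFun_eq hm] at h1
  obtain ⟨a, ha, -⟩ := hf.exists_real_of_resolventFun_le hadm hη h1
  refine ⟨a, ha, ?_⟩
  rcases (dist_nonneg (x := p) (y := z)).eq_or_lt with h0 | h0
  · rw [← h0]; simp
  set D := dist p z
  set c := Real.cos (dist z x)
  set B := Real.cos (dist p x)
  have hc : 0 < c := hadm.cos_pos _ _
  have hB : 0 < B := hadm.cos_pos _ _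
  have hD : D < Real.pi / 2 := hadm p z
  have hs : 0 < Real.sin D := Real.sin_pos_of_pos_of_lt_pi h0 (by linarith)
  let C : ℝ → ℝ := fun t => (Real.sin (t * D) * B + Real.sin ((1 - t) * D) * c) / Real.sin D
  -- At the point with weight `t` on `p` and `1 - t` on `z`, `C t` bounds the cosine from below and
  -- `a - t(a - m)` bounds `f` from above. So `k t + η a` majorizes the functional there, with
  -- equality at `t = 0`, where it is minimal; hence the right derivative of `k` at `0` is
  -- nonnegative.
  let k : ℝ → ℝ := fun t => (C t)⁻¹ - C t - η * (t * (a - m))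
  have hC0 : C 0 = c := by
    simp only [C]; simp [hs.ne']
  have hk : ∀ t ∈ Ioo (0 : ℝ) 1, k 0 ≤ k t := by
    intro t ht
    obtain ⟨w, hw⟩ := hcat.exists_convComb hadm t p z
    obtain ⟨b, hb, hbt⟩ := hf.exists_real_convComb hm ha ht.1 ht.2 hw
    have h2 := hz w
    rw [hadm.resolventFun_eq ha, hadm.resolventFun_eq hb, EReal.coe_le_coe_iff] at h2
    have h3 := hcat.cos_convComb hadm x ⟨ht.1.le, ht.2.le⟩ hw
    have h4 : C t ≤ Real.cos (dist w x) := by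
      rw [div_le_iff₀ hs]; linarith
    have h5 : 0 < C t := by
      have e1 : 0 < Real.sin (t * D) := Real.sin_pos_of_pos_of_lt_pi (mul_pos ht.1 h0)
        (by nlinarith [ht.2])
      have e2 : 0 < Real.sin ((1 - t) * D) := Real.sin_pos_of_pos_of_lt_pi
        (mul_pos (by linarith [ht.2]) h0) (by nlinarith [ht.1])
      positivity
    have h6 : (Real.cos (dist w x))⁻¹ ≤ (C t)⁻¹ := inv_anti₀ h5 h4
    simp only [k, hC0]
    nlinarith
  have hCd : HasDerivAt C ((D * B - D * Real.cos D * c) / Real.sin D) 0 := by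
    have e1 : HasDerivAt (fun t : ℝ => Real.sin (t * D)) D 0 := by
      have := ((hasDerivAt_id (0 : ℝ)).mul_const D).sin
      simpa using this
    have e2 : HasDerivAt (fun t : ℝ => Real.sin ((1 - t) * D)) (-(D * Real.cos D)) 0 := by
      have := (((hasDerivAt_id (0 : ℝ)).const_sub 1).mul_const D).sin
      simp only [id, sub_zero, one_mul] at this
      convert this using 1; ring
    exact (((e1.mul_const B).add (e2.mul_const c)).div_const (Real.sin D)).congr_deriv (by ring)
  have hkd : HasDerivAt k (-((D * B - D * Real.cos D * c) / Real.sin D) / c ^ 2 -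
      (D * B - D * Real.cos D * c) / Real.sin D - η * (a - m)) 0 := by
    have e1 := hCd.fun_inv (by rw [hC0]; exact hc.ne')
    rw [hC0] at e1
    have e2 : HasDerivAt (fun t : ℝ => η * (t * (a - m))) (η * (a - m)) 0 := by
      simpa using ((hasDerivAt_id (0 : ℝ)).mul_const (a - m)).const_mul η
    exact (e1.sub hCd).sub e2
  have hnn := ge_of_tendsto (b := 0) hkd.tendsto_slope_zero_right (by
    filter_upwards [Ioo_mem_nhdsGT (show (0 : ℝ) < 1 by norm_num)] with t ht
    rw [zero_add, smul_eq_mul]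
    exact mul_nonneg (inv_nonneg.2 ht.1.le) (by linarith [hk t ht]))
  have := mul_nonneg hnn hs.le
  have e : (-((D * B - D * Real.cos D * c) / Real.sin D) / c ^ 2 -
      (D * B - D * Real.cos D * c) / Real.sin D - η * (a - m)) * Real.sin D =
      (1 + (c ^ 2)⁻¹) * (D * (Real.cos D * c - B)) - η * (a - m) * Real.sin D := by
    field_simp; ring
  linarith

/-- A spherical Pythagorean inequality: since `f z ≥ f p`, the left side of the variational
inequality is nonnegative, and so is the bracket on the right. -/
theorem IsGamma0.resolvent_cos_le (hcat : IsCAT1 X) (hadm : IsAdmissible X) (hf : IsGamma0 f)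
    {x z p : X} {η : ℝ} (hη : 0 < η) (hz : z ∈ argmin (resolventFun (scale η f) x))
    (hp : p ∈ argmin f) :
    Real.cos (dist p x) ≤ Real.cos (dist p z) * Real.cos (dist z x) := by
  obtain ⟨m, hm⟩ := hf.exists_real_of_mem_argmin hp
  obtain ⟨a, ha, h⟩ := hf.resolvent_variational hcat hadm hη hz hm
  rcases (dist_nonneg (x := p) (y := z)).eq_or_lt with h0 | h0
  · rw [dist_eq_zero.1 h0.symm]; simp
  have ham : m ≤ a := by
    have := hp z
    rw [hm, ha] at this
    exact_mod_cast this
  have hs : 0 < Real.sin (dist p z) := Real.sin_pos_of_pos_of_lt_pi h0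
    (by linarith [hadm p z, Real.pi_pos])
  have h1 : 0 ≤ η * (a - m) * Real.sin (dist p z) :=
    mul_nonneg (mul_nonneg hη.le (by linarith)) hs.le
  have h2 : 0 < 1 + (Real.cos (dist z x) ^ 2)⁻¹ := by
    have := hadm.cos_pos z x
    positivity
  by_contra! h3
  have : (1 + (Real.cos (dist z x) ^ 2)⁻¹) * (dist p z *
      (Real.cos (dist p z) * Real.cos (dist z x) - Real.cos (dist p x))) < 0 :=
    mul_neg_of_pos_of_neg h2 (mul_neg_of_pos_of_neg h0 (by linarith))
  linarith

/-- A bound for the excess of `f` at the resolvent. -/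
theorem IsGamma0.resolvent_value_le (hcat : IsCAT1 X) (hadm : IsAdmissible X) (hf : IsGamma0 f)
    {x z p : X} {η m : ℝ} (hη : 0 < η) (hz : z ∈ argmin (resolventFun (scale η f) x))
    (hp : p ∈ argmin f) (hm : f p = m) :
    ∃ a : ℝ, f z = a ∧ η * (a - m) ≤ 2 * (1 + (Real.cos (dist p x) ^ 2)⁻¹) *
      (Real.cos (dist p z) - Real.cos (dist p x)) := by
  obtain ⟨a, ha, h⟩ := hf.resolvent_variational hcat hadm hη hz hm
  have h1 := hf.resolvent_cos_le hcat hadm hη hz hp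
  refine ⟨a, ha, ?_⟩
  set D := dist p z
  set c := Real.cos (dist z x)
  set B := Real.cos (dist p x)
  have hc : 0 < c := hadm.cos_pos _ _
  have hB : 0 < B := hadm.cos_pos _ _
  have hD1 : 0 < Real.cos D := hadm.cos_pos _ _
  have hD2 : Real.cos D ≤ 1 := Real.cos_le_one _
  have hc1 : c ≤ 1 := Real.cos_le_one _
  rcases (dist_nonneg (x := p) (y := z)).eq_or_lt with h0 | h0
  · have hpz : p = z := dist_eq_zero.1 h0.symm
    have : a = m := by
      rw [← hpz, hm] at ha
      exact_mod_cast ha.symm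
    rw [this, sub_self, mul_zero]
    have : 0 ≤ Real.cos D - B := by nlinarith
    positivity
  have hBc : B ≤ c := by nlinarith
  -- Replacing the factor `D` by `2 sin D` allows `sin D` to be cancelled; this is the source of the
  -- constant `2`.
  have hsin : D ≤ 2 * Real.sin D := by
    have h2 := Real.mul_le_sin h0.le (hadm p z).le
    have : (1 : ℝ) / 2 ≤ 2 / Real.pi := by
      rw [div_le_div_iff₀ (by norm_num) Real.pi_pos]; linarith [Real.pi_le_four]
    nlinarith
  have hs : 0 < Real.sin D := by linarith
  have hinv : (c ^ 2)⁻¹ ≤ (B ^ 2)⁻¹ := by gcongr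
  refine le_of_mul_le_mul_right ?_ hs
  calc η * (a - m) * Real.sin D ≤ (1 + (c ^ 2)⁻¹) * (D * (Real.cos D * c - B)) := h
    _ ≤ (1 + (B ^ 2)⁻¹) * ((2 * Real.sin D) * (Real.cos D - B)) := by
      have : Real.cos D * c ≤ Real.cos D := by nlinarith
      gcongr
    _ = _ := by ring

/-! ### Real-variable estimates -/

theorem tendsto_zero_of_eventually_contracting {s a : ℕ → ℝ} (hs : ∀ n, 0 ≤ s n)
    (ha1 : ∀ n, a n ≤ 1) (hsum : Tendsto (fun N => ∑ n ∈ Finset.range N, a n) atTop atTop)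
    (h : ∀ ε > 0, ∀ᶠ n in atTop, s (n + 1) - ε ≤ (1 - a n) * max (s n - ε) 0) :
    Tendsto s atTop (𝓝 0) := by
  rw [Metric.tendsto_atTop']
  intro ε hε
  obtain ⟨N, hN⟩ := eventually_atTop.1 (h (ε / 2) (by linarith))
  -- Truncating absorbs the error: `u (n+1) ≤ (1 - a n) * u n ≤ exp (-a n) * u n` from `N` on, so
  -- nothing accumulates and the divergent sum drives `u` to zero.
  let u : ℕ → ℝ := fun n => max (s n - ε / 2) 0
  let S : ℕ → ℝ := fun N => ∑ n ∈ Finset.range N, a n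
  have hu0 : ∀ n, 0 ≤ u n := fun n => le_max_right _ _
  have hu : ∀ n ≥ N, u n ≤ Real.exp (S N - S n) * u N := by
    intro n hn
    induction n, hn using Nat.le_induction with
    | base => simp
    | succ n hn ih =>
      have h1 : u (n + 1) ≤ (1 - a n) * u n :=
        max_le (hN n hn) (mul_nonneg (by linarith [ha1 n]) (hu0 n))
      have h2 : 1 - a n ≤ Real.exp (-a n) := by linarith [Real.add_one_le_exp (-a n)]
      have h3 : S (n + 1) = S n + a n := Finset.sum_range_succ _ _
      calc u (n + 1) ≤ (1 - a n) * u n := h1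
        _ ≤ Real.exp (-a n) * (Real.exp (S N - S n) * u N) := by
          gcongr
        _ = _ := by rw [← mul_assoc, ← Real.exp_add, h3]; congr 2; ring
  have hlim : Tendsto (fun n => Real.exp (S N - S n) * u N) atTop (𝓝 0) := by
    have : Tendsto (fun n => S N - S n) atTop atBot :=
      tendsto_const_nhds.add_atBot (tendsto_neg_atTop_atBot.comp hsum)
    simpa using (Real.tendsto_exp_atBot.comp this).mul_const (u N)
  obtain ⟨M, hM⟩ := eventually_atTop.1 (hlim.eventually_lt_const (show 0 < ε / 2 by linarith))
  refine ⟨max N M, fun n hn => ?_⟩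
  have h1 := hu n (le_of_lt (lt_of_le_of_lt (le_max_left _ _) hn))
  have h2 := hM n (le_of_lt (lt_of_le_of_lt (le_max_right _ _) hn))
  have h3 : s n - ε / 2 ≤ u n := le_max_left _ _
  rw [Real.dist_eq, sub_zero, abs_of_nonneg (hs n)]
  linarith

theorem half_le_sin {x : ℝ} (h0 : 0 ≤ x) (h1 : x ≤ Real.pi / 2) : x / 2 ≤ Real.sin x := by
  have h2 := Real.mul_le_sin h0 h1
  have : (1 : ℝ) / 2 ≤ 2 / Real.pi := by
    rw [div_le_div_iff₀ (by norm_num) Real.pi_pos]; linarith [Real.pi_le_four]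
  nlinarith

theorem one_sub_cos_eq (x : ℝ) : 1 - Real.cos x = 2 * Real.sin (x / 2) ^ 2 := by
  have h := Real.cos_two_mul (x / 2)
  rw [show 2 * (x / 2) = x by ring, Real.cos_sq'] at h
  linarith

/-- The sine is flat near `π/2`, so a gain uniform in `l` can only be quadratic in `a`; hence the
condition on the sum of squares. For `l ≤ 1` the gain comes from `cos l * sin (a l)`, for `l ≥ 1`
from `1 - cos (a l) ≥ a²/8`. -/
theorem sin_one_sub_mul_le {l a : ℝ} (hl0 : 0 ≤ l) (hl : l < Real.pi / 2) (ha0 : 0 ≤ a)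
    (ha1 : a ≤ 1) : Real.sin ((1 - a) * l) ≤ (1 - a ^ 2 / 10) * Real.sin l := by
  have hθ0 : 0 ≤ a * l := mul_nonneg ha0 hl0
  have hθl : a * l ≤ l := by nlinarith
  rw [show (1 - a) * l = l - a * l by ring, Real.sin_sub]
  have hs0 : 0 ≤ Real.sin l := Real.sin_nonneg_of_nonneg_of_le_pi hl0 (by linarith)
  have hc0 : 0 < Real.cos l := Real.cos_pos_of_mem_Ioo ⟨by linarith, hl⟩
  have h1 : a * l / 2 ≤ Real.sin (a * l) := half_le_sin hθ0 (by linarith)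
  have h2 : 0 ≤ 1 - Real.cos (a * l) := by linarith [Real.cos_le_one (a * l)]
  rcases le_total l 1 with h | h
  · have h3 : 1 / 2 ≤ Real.cos l := by
      have := Real.one_sub_sq_div_two_le_cos (x := l)
      nlinarith
    have h4 : Real.sin l ≤ l := Real.sin_le hl0
    have h5 : a ^ 2 * Real.sin l ≤ a * l := by
      rw [sq, mul_assoc]
      exact mul_le_mul_of_nonneg_left (by nlinarith) ha0
    nlinarith [mul_nonneg hs0 h2, mul_le_mul h3 h1 (by linarith) hc0.le]
  · have h3 : a * l / 2 / 2 ≤ Real.sin (a * l / 2) := half_le_sin (by linarith) (by linarith)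
    have h4 : a / 4 ≤ Real.sin (a * l / 2) := by nlinarith
    have h5 : a ^ 2 / 8 ≤ 1 - Real.cos (a * l) := by rw [one_sub_cos_eq]; nlinarith
    have h6 : 0 ≤ Real.cos l * Real.sin (a * l) := mul_nonneg hc0.le (by linarith)
    nlinarith [mul_le_mul_of_nonneg_left h5 hs0, mul_nonneg hs0 (sq_nonneg a)]

/-- Controls the weight lost by `z` in a Halpern step by the weight `sin (a l)` given to `v`. With
`θ = a l`, the second-order term satisfies `1 - cos θ ≤ θ²/2 ≤ θ sin θ`. -/
theorem sin_sub_sin_one_sub_mul_le {l a : ℝ} (hl0 : 0 ≤ l) (hl : l < Real.pi / 2) (ha0 : 0 ≤ a)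
    (ha1 : a ≤ 1) :
    Real.sin l - Real.sin ((1 - a) * l) ≤ Real.sin (a * l) * (Real.cos l + a * l) := by
  have hθ0 : 0 ≤ a * l := mul_nonneg ha0 hl0
  have hθl : a * l ≤ l := by nlinarith
  rw [show (1 - a) * l = l - a * l by ring, Real.sin_sub]
  have h1 : a * l / 2 ≤ Real.sin (a * l) := half_le_sin hθ0 (by linarith)
  have h2 : 1 - Real.cos (a * l) ≤ (a * l) ^ 2 / 2 := by
    linarith [Real.one_sub_sq_div_two_le_cos (x := a * l)]
  have h3 : 0 ≤ 1 - Real.cos (a * l) := by linarith [Real.cos_le_one (a * l)]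
  have h4 : Real.sin l * (1 - Real.cos (a * l)) ≤ 1 - Real.cos (a * l) := by
    nlinarith [Real.sin_le_one l]
  nlinarith

/-! ### The Halpern step and convergence -/

theorem IsConvComb.dist_left {a : ℝ} {x y z : X} (ha : a ∈ Icc (0 : ℝ) 1)
    (h : IsConvComb a x y z) : dist x z = (1 - a) * dist x y := by
  obtain ⟨c, hc, rfl⟩ := h
  have h0 : 0 ≤ dist x y := dist_nonneg
  have h1 : 0 ≤ (1 - a) * dist x y := mul_nonneg (by linarith [ha.2]) h0
  have := hc.2.2 0 ⟨le_rfl, h0⟩ ((1 - a) * dist x y) ⟨h1, by nlinarith [ha.1]⟩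
  rwa [hc.1, zero_sub, abs_neg, abs_of_nonneg h1] at this

theorem IsConvComb.dist_right {a : ℝ} {x y z : X} (ha : a ∈ Icc (0 : ℝ) 1)
    (h : IsConvComb a x y z) : dist z y = a * dist x y := by
  obtain ⟨c, hc, rfl⟩ := h
  have h0 : 0 ≤ dist x y := dist_nonneg
  have h1 : 0 ≤ (1 - a) * dist x y := mul_nonneg (by linarith [ha.2]) h0
  have := hc.2.2 ((1 - a) * dist x y) ⟨h1, by nlinarith [ha.1]⟩ _ ⟨h0, le_rfl⟩
  rw [hc.2.1, abs_sub_comm, abs_of_nonneg (by nlinarith [ha.1])] at this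
  rw [this]; ring

/-- Balls of radius less than `π / 2` are convex. -/
theorem IsCAT1.le_cos_convComb (hcat : IsCAT1 X) (hadm : IsAdmissible X) {x y z w : X} {a c : ℝ}
    (ha : a ∈ Icc (0 : ℝ) 1) (hc : 0 ≤ c) (h : IsConvComb a x y z)
    (hx : c ≤ Real.cos (dist x w)) (hy : c ≤ Real.cos (dist y w)) :
    c ≤ Real.cos (dist z w) := by
  have h0 : 0 ≤ dist x y := dist_nonneg
  rcases h0.eq_or_lt with h0 | h0
  · have := h.dist_left ha
    rw [← h0, mul_zero] at this
    rwa [← dist_eq_zero.1 this]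
  have hl := hadm x y
  have key := hcat.cos_convComb hadm w ha h
  set l := dist x y
  have hs : 0 < Real.sin l := Real.sin_pos_of_pos_of_lt_pi h0 (by linarith)
  have hs1 : 0 ≤ Real.sin (a * l) := Real.sin_nonneg_of_nonneg_of_le_pi
    (mul_nonneg ha.1 h0.le) (by nlinarith [ha.2])
  have hs2 : 0 ≤ Real.sin ((1 - a) * l) := Real.sin_nonneg_of_nonneg_of_le_pi
    (mul_nonneg (by linarith [ha.2]) h0.le) (by nlinarith [ha.1])
  have hadd : Real.sin l ≤ Real.sin (a * l) + Real.sin ((1 - a) * l) := by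
    have : Real.sin l = Real.sin (a * l + (1 - a) * l) := by congr 1; ring
    rw [this, Real.sin_add]
    nlinarith [Real.cos_le_one (a * l), Real.cos_le_one ((1 - a) * l)]
  refine le_of_mul_le_mul_left ?_ hs
  nlinarith [mul_le_mul_of_nonneg_left hx hs1, mul_le_mul_of_nonneg_left hy hs2,
    mul_le_mul_of_nonneg_left hadd hc]

/-- One step of the Halpern iteration towards `v`, from a point `z` not nearer to `v` than `p`, up
to the error `ε`. -/
theorem IsCAT1.halpern_step (hcat : IsCAT1 X) (hadm : IsAdmissible X) {v z w p : X} {a ε : ℝ}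
    (ha : a ∈ Icc (0 : ℝ) 1) (hε : ε ≤ 1) (h : IsConvComb a v z w)
    (hP : (1 - ε) * (Real.cos (dist v z) + a * dist v z) ≤ Real.cos (dist v p)) :
    1 - Real.cos (dist w p) - ε ≤ (1 - a ^ 2 / 10) * max (1 - Real.cos (dist z p) - ε) 0 := by
  have h0 : 0 ≤ dist v z := dist_nonneg
  have ha2 : 0 ≤ 1 - a ^ 2 / 10 := by nlinarith [ha.1, ha.2]
  rcases h0.eq_or_lt with h0 | h0
  · have := h.dist_left ha
    rw [← h0, mul_zero] at this
    rw [← dist_eq_zero.1 this]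
    rw [← h0, Real.cos_zero] at hP
    refine le_trans (by linarith) (mul_nonneg ha2 (le_max_right _ _))
  have hl := hadm v z
  have key := hcat.cos_convComb hadm p ha h
  have h1 := sin_sub_sin_one_sub_mul_le h0.le hl ha.1 ha.2
  have h2 := sin_one_sub_mul_le h0.le hl ha.1 ha.2
  set l := dist v z
  set M := max (1 - Real.cos (dist z p) - ε) 0
  have hM0 : 0 ≤ M := le_max_right _ _
  have hM : 1 - Real.cos (dist z p) - ε ≤ M := le_max_left _ _
  have hs : 0 < Real.sin l := Real.sin_pos_of_pos_of_lt_pi h0 (by linarith)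
  have hs1 : 0 ≤ Real.sin (a * l) := Real.sin_nonneg_of_nonneg_of_le_pi
    (mul_nonneg ha.1 h0.le) (by nlinarith [ha.2])
  have hs2 : 0 ≤ Real.sin ((1 - a) * l) := Real.sin_nonneg_of_nonneg_of_le_pi
    (mul_nonneg (by linarith [ha.2]) h0.le) (by nlinarith [ha.1])
  -- `h3` and `h4` give `(1-ε)(sin l - sin ((1-a)l)) ≤ sin (a l) cos d(v,p)`. Inserted in `key`,
  -- this leaves `sin ((1-a)l)` times the old excess; the truncation `M ≥ 0` lets that sine be
  -- replaced by its upper bound.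
  have h3 := mul_le_mul_of_nonneg_left h1 (show 0 ≤ 1 - ε by linarith)
  have h4 := mul_le_mul_of_nonneg_left hP hs1
  have h5 := mul_le_mul_of_nonneg_left hM hs2
  have h6 := mul_le_mul_of_nonneg_right h2 hM0
  refine le_of_mul_le_mul_left ?_ hs
  linarith

theorem IsAdmissible.tendsto_of_cos (hadm : IsAdmissible X) {u : ℕ → X} {p : X} {s : ℕ → ℝ}
    (hs : Tendsto s atTop (𝓝 0)) (h : ∀ n, 1 - Real.cos (dist (u n) p) ≤ s n) :
    Tendsto u atTop (𝓝 p) := by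
  rw [tendsto_iff_dist_tendsto_zero]
  refine squeeze_zero (g := fun n => √(32 * s n)) (fun _ => dist_nonneg) (fun n => ?_) ?_
  · apply Real.le_sqrt_of_sq_le
    have h1 := hadm.sq_dist_le (u n) p
    have h2 : Real.cos (dist (u n) p) ≤ Real.cos (dist (u n) p / 2) := by
      have h0 : 0 ≤ dist (u n) p := dist_nonneg
      exact Real.cos_le_cos_of_nonneg_of_le_pi (by linarith)
        (by linarith [hadm (u n) p, Real.pi_pos]) (by linarith)
    linarith [h n]
  · simpa using (hs.const_mul 32).sqrt

/-- Convergence of the Halpern type proximal point algorithm. -/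
theorem IsGamma0.tendsto_proximal [CompleteSpace X] (hcat : IsCAT1 X) (hadm : IsAdmissible X)
    (hf : IsGamma0 f) {v p : X} (hp : IsNearestPoint (argmin f) v p) {α lam : ℕ → ℝ} {lam₀ : ℝ}
    (hα : ∀ n, α n ∈ Ioc (0 : ℝ) 1) (hα_lim : Tendsto α atTop (𝓝 0))
    (hα_sum : Tendsto (fun N => ∑ n ∈ Finset.range N, α n ^ 2) atTop atTop)
    (hlam₀ : 0 < lam₀) (hlam : ∀ n, lam₀ ≤ lam n) {y z : ℕ → X}
    (hz : ∀ n, z n ∈ argmin (resolventFun (scale (lam n) f) (y n)))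
    (hy : ∀ n, IsConvComb (α n) v (z n) (y (n + 1))) :
    Tendsto y atTop (𝓝 p) ∧ Tendsto z atTop (𝓝 p) := by
  obtain ⟨m, hm⟩ := hf.exists_real_of_mem_argmin hp.1
  have hαI : ∀ n, α n ∈ Icc (0 : ℝ) 1 := fun n => Ioc_subset_Icc_self (hα n)
  have hlam0 : ∀ n, 0 < lam n := fun n => hlam₀.trans_le (hlam n)
  set P := Real.cos (dist v p)
  have hP : 0 < P := hadm.cos_pos _ _
  have hYZ : ∀ n, Real.cos (dist (y n) p) ≤ Real.cos (dist (z n) p) := by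
    intro n
    have h1 := hf.resolvent_cos_le hcat hadm (hlam0 n) (hz n) hp.1
    rw [dist_comm (y n), dist_comm (z n)]
    exact h1.trans (mul_le_of_le_one_right (hadm.cos_pos _ _).le (Real.cos_le_one _))
  -- The ball around `p` where the cosine is at least `c₀` contains `v` and `y 0`, is convex, and is
  -- preserved by the resolvents, so it contains every `y n`. This makes the constant in the value
  -- estimate uniform in `n`.
  set c₀ := min P (Real.cos (dist (y 0) p))
  have hc₀ : 0 < c₀ := lt_min hP (hadm.cos_pos _ _)
  have hYc : ∀ n, c₀ ≤ Real.cos (dist (y n) p) := by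
    intro n
    induction n with
    | zero => exact min_le_right _ _
    | succ n ih =>
      exact hcat.le_cos_convComb hadm (hαI n) hc₀.le (hy n) (min_le_left _ _) (ih.trans (hYZ n))
  set K := 2 * (1 + (c₀ ^ 2)⁻¹) / lam₀
  have hK : 0 < K := by positivity
  have hval : ∀ n, ∃ a : ℝ, f (z n) = a ∧
      a ≤ m + K * (Real.cos (dist (z n) p) - Real.cos (dist (y n) p)) := by
    intro n
    obtain ⟨a, ha, h⟩ := hf.resolvent_value_le hcat hadm (hlam0 n) (hz n) hp.1 hm
    refine ⟨a, ha, ?_⟩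
    have ham : m ≤ a := by
      have := hp.1 (z n)
      rw [hm, ha] at this
      exact_mod_cast this
    rw [dist_comm p, dist_comm p] at h
    have h1 := hYc n
    have h2 := hYZ n
    have h3 : lam₀ * (a - m) ≤ 2 * (1 + (c₀ ^ 2)⁻¹) *
        (Real.cos (dist (z n) p) - Real.cos (dist (y n) p)) :=
      calc lam₀ * (a - m) ≤ lam n * (a - m) :=
            mul_le_mul_of_nonneg_right (hlam n) (by linarith)
        _ ≤ _ := h
        _ ≤ _ := mul_le_mul_of_nonneg_right (by gcongr) (by linarith)
    have h4 : K * (Real.cos (dist (z n) p) - Real.cos (dist (y n) p)) =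
        2 * (1 + (c₀ ^ 2)⁻¹) *
        (Real.cos (dist (z n) p) - Real.cos (dist (y n) p)) / lam₀ := by ring
    have h5 : a - m ≤ K * (Real.cos (dist (z n) p) - Real.cos (dist (y n) p)) := by
      rw [h4, le_div_iff₀ hlam₀]; linarith
    linarith
  have hs : Tendsto (fun n => 1 - Real.cos (dist (y n) p)) atTop (𝓝 0) := by
    refine tendsto_zero_of_eventually_contracting (a := fun n => α n ^ 2 / 10)
      (fun n => by linarith [Real.cos_le_one (dist (y n) p)])
      (fun n => by nlinarith [(hα n).1, (hα n).2]) ?_ ?_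
    · simp_rw [← Finset.sum_div]
      exact hα_sum.atTop_div_const (by norm_num)
    intro ε hε
    rcases le_or_gt 1 ε with hε1 | hε1
    · refine Eventually.of_forall fun n => le_trans ?_
        (mul_nonneg (by nlinarith [(hα n).1, (hα n).2]) (le_max_right _ _))
      linarith [hadm.cos_pos (y (n + 1)) p]
    -- Half of the tolerance `ε P` goes to the gap, half to `α n * d(v, z n)`; then `(1 - ε)(P + ε
    -- P) ≤ P`.
    obtain ⟨δ₁, hδ₁, hgap⟩ := hf.exists_gap hcat hadm hp hm (c := P + ε * P / 2)
      (by show P < _; nlinarith)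
    set δ := δ₁ / (2 * K)
    have hδ : 0 < δ := by positivity
    have hKδ : K * (2 * δ) = δ₁ := by simp only [δ]; field_simp
    filter_upwards [hα_lim.eventually_lt_const (show 0 < δ / 2 by linarith),
      hα_lim.eventually_lt_const (show 0 < ε * P / 4 by positivity)] with n hn1 hn2
    have hαn := hα n
    have hαs : α n ^ 2 ≤ α n := by nlinarith [hαn.1, hαn.2]
    have hl2 : dist v (z n) ≤ 2 := by linarith [hadm v (z n), Real.pi_le_four]
    have hYZn := hYZ n
    -- Either `s` drops by more than `δ`, which beats the loss `α n ^ 2 / 10`, or, `z n` being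
    -- within `δ` of `y (n+1)`, the resolvent step raises the cosine by at most `2δ` and `f (z n) ≤
    -- m + δ₁`.
    rcases lt_or_ge (1 - Real.cos (dist (y (n + 1)) p)) (1 - Real.cos (dist (y n) p) - δ)
      with hcase | hcase
    · have hu1 : max (1 - Real.cos (dist (y n) p) - ε) 0 ≤ 1 :=
        max_le (by linarith [hadm.cos_pos (y n) p]) zero_le_one
      have hu2 := le_max_left (1 - Real.cos (dist (y n) p) - ε) 0
      have hu0 := le_max_right (1 - Real.cos (dist (y n) p) - ε) 0
      nlinarith [sq_nonneg (α n)]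
    · have hdist : dist (y (n + 1)) (z n) ≤ δ := by
        rw [(hy n).dist_right (hαI n)]
        nlinarith [hαn.1]
      have hZY : Real.cos (dist (z n) p) - Real.cos (dist (y (n + 1)) p) ≤ δ := by
        have h1 := Real.abs_cos_sub_cos_le (dist (z n) p) (dist (y (n + 1)) p)
        have h2 := abs_dist_sub_le (z n) (y (n + 1)) p
        exact (le_abs_self _).trans (h1.trans (h2.trans (by rwa [dist_comm])))
      obtain ⟨a, ha, ham⟩ := hval n
      have hL := hgap (z n) a ha (by
        rw [← hKδ]
        refine ham.trans (by gcongr; linarith))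
      have hstep := hcat.halpern_step hadm (p := p) (hαI n) hε1.le (hy n) (by
        have : α n * dist v (z n) ≤ ε * P / 2 := by nlinarith [hαn.1]
        change _ ≤ P
        calc (1 - ε) * (Real.cos (dist v (z n)) + α n * dist v (z n)) ≤ (1 - ε) * (P + ε * P) :=
              mul_le_mul_of_nonneg_left (by linarith) (by linarith)
          _ ≤ P := by nlinarith [mul_nonneg (sq_nonneg ε) hP.le])
      refine hstep.trans (mul_le_mul_of_nonneg_left (max_le_max_right 0 (by linarith)) ?_)
      linarith [hαn.2]
  exact ⟨hadm.tendsto_of_cos hs fun n => le_rfl,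
    hadm.tendsto_of_cos hs fun n => by linarith [hYZ n]⟩

end CatOne

theorem theorem5p2 {X : Type*} [MetricSpace X] [CompleteSpace X]
    (hcat : CatOne.IsCAT1 X) (hadm : CatOne.IsAdmissible X)
    (f : X → EReal) (hf : CatOne.IsGamma0 f) (v : X)
    (α lam : ℕ → ℝ)
    (hα : ∀ n, α n ∈ Set.Ioc (0 : ℝ) 1)
    (hα_lim : Tendsto α atTop (𝓝 0))
    (hα_sum : Tendsto (fun N => ∑ n ∈ Finset.range N, α n ^ 2) atTop atTop)
    (hlam : ∀ n, 0 < lam n) (hlam_inf : 0 < ⨅ n, lam n)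
    (y : ℕ → X)
    (hy : ∀ n, CatOne.IsConvComb (α n) v
      (CatOne.resolvent (CatOne.scale (lam n) f) (y n)) (y (n + 1)))
    (hne : (CatOne.argmin f).Nonempty) :
    (∀ η : ℝ, 0 < η → ∀ x : X, ∃! z,
      z ∈ CatOne.argmin (CatOne.resolventFun (CatOne.scale η f) x)) ∧
    (∀ x : X, ∃! p, CatOne.IsNearestPoint (CatOne.argmin f) x p) ∧
    Tendsto y atTop (𝓝 (CatOne.metricProj (CatOne.argmin f) v)) ∧
    Tendsto (fun n => CatOne.resolvent (CatOne.scale (lam n) f) (y n)) atTop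
      (𝓝 (CatOne.metricProj (CatOne.argmin f) v)) := by
  have hres : ∀ η : ℝ, 0 < η → ∀ x : X, ∃! z,
      z ∈ CatOne.argmin (CatOne.resolventFun (CatOne.scale η f) x) :=
    fun η hη x => hf.existsUnique_resolvent hcat hadm hne hη x
  have hproj : ∀ x : X, ∃! p, CatOne.IsNearestPoint (CatOne.argmin f) x p :=
    hf.existsUnique_isNearestPoint_argmin hcat hadm hne
  exact ⟨hres, hproj, hf.tendsto_proximal hcat hadm
    (CatOne.isNearestPoint_metricProj (hproj v).exists) hα hα_lim hα_sum hlam_inf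
    (fun n => ciInf_le ⟨0, by rintro _ ⟨k, rfl⟩; exact (hlam k).le⟩ n)
    (fun n => CatOne.resolvent_mem (hres _ (hlam n) (y n)).exists) hy⟩
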